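/- Let $\mathbb F_q$ be a finite field, $K_\infty=\mathbb F_q((1/\theta))$ with $|\theta|=q$, let $\mathbb C_\infty$ be the completion of an algebraic closure of $K_\infty$, and let $\mathbb T\subset\mathbb C_\infty[[t]]$ be the Tate algebra of power series whose coefficients tend to $0$. Let $\phi$ be a Drinfeld $\mathbb F_q[x]$-module of rank $r\ge 1$ over $\mathbb C_\infty$, given by $\phi_x=\theta+g_1\tau+\dots+g_r\tau^r$ with $g_i\in\mathbb C_\infty$, $g_r\neq 0$, $\tau$ the $q$-power Frobenius. Let $\exp_\phi(z)=\sum_{i\ge 0}e_iz^{q^i}$ be its exponential ($e_0=1$, $\phi_x\exp_\phi=\exp_\phi\theta$), $\Lambda_\phi=\ker\exp_\phi$ its lattice, and for $z\in\mathbb C_\infty$ let $\omega_z(t)=\sum_{k\ge 0}\exp_\phi(z/\theta^{k+1})\,t^k\in\mathbb T$ be the Anderson generating function. Let $\mathfrak f=a_nt^n+\dots+a_0\in\mathbb F_q[t]$ be monic of degree $n$ (so $a_n=1$). For $\omega\in\mathbb T$ the $\mathfrak f$-remainder $[\omega]_{\mathfrak f}\in\mathbb C_\infty[t]$ is the polynomial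 of degree $<n$ representing $\omega(\bar t)\in\mathbb C_\infty[t]/\mathfrak f\,\mathbb C_\infty[t]$, where $\bar t$ is the class of $t$ and the quotient carries the norm $\|\sum_{i<n}g_i\bar t^i\|=\max_i|g_i|$. For $0\le i<n$ put $D_{\mathfrak f}(x^i)=\sum_{j=0}^{n-i-1}a_{i+j+1}x^j$, and let $O^{(2)}_{\mathfrak f}(x,t)=\sum_{k=0}^{n-1}D_{\mathfrak f}(x^k)\,t^k$ be the rank-two Weil operator. For $P=\sum_k p_k(t)x^k\in\mathbb F_q[t][x]$ and $\mu\in\mathbb C_\infty$ put $P\diamond_\phi\mu=\sum_k p_k(t)\,\phi_{x^k}(\mu)\in\mathbb C_\infty[t]$. Let $z\in\Lambda_\phi$ and write $[\omega_z(t)]_{\mathfrak f}=\sum_{i=0}^{n-1}C_{z,i}\,t^i$. Then: 1. if $n\ge 1$, $[\omega_z(t)]_{\mathfrak f}=O^{(2)}_{\mathfrak f}(x,t)\diamond_\phi C_{z,n-1}=\sum_{i=0}^{n-1}\phi_{D_{\mathfrak f}(x^i)}(C_{z,n-1})\,t^i$; 2. $[\omega_z(t)]_{\mathfrak f}=O^{(2)}_{\mathfrak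 f}(x,t)\diamond_\phi\exp_\phi\!\big(\tfrac{z}{\mathfrak f(\theta)}\big)=\sum_{i=0}^{n-1}\phi_{D_{\mathfrak f}(x^i)}\!\big(\exp_\phi(\tfrac{z}{\mathfrak f(\theta)})\big)\,t^i$; 3. $C_{z,i}=\phi_{D_{\mathfrak f}(x^i)}\!\big(\exp_\phi(\tfrac{z}{\mathfrak f(\theta)})\big)$ for $0\le i<n$; 4. if $n\ge 1$, the coefficient of $t^{n-1}$ is $C_{z,n-1}=\exp_\phi\!\big(\tfrac{z}{\mathfrak f(\theta)}\big)$. -/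

import Mathlib

open Polynomial
open scoped NNReal

noncomputable section

namespace DrinfeldWeil

/-! ### The fields `K_∞` and `ℂ_∞` -/

section Fields

variable (Fq : Type*) [Field Fq]

open scoped Classical in
/-- `K_∞ = 𝔽_q((1/θ))`, the completion of `𝔽_q(θ)` at the infinite place. -/
abbrev KInfty : Type _ := RatFunc.CompletionAtInfty Fq

open scoped Classical in
lemma KInfty.valued_coe (x : RatFunc Fq) :
    Valued.v (algebraMap (RatFunc Fq) (KInfty Fq) x) = RatFunc.inftyValuation Fq x :=
  letI := RatFunc.inftyValued Fq
  Valued.extensionValuation_apply_coe x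

variable [Fintype Fq]

lemma one_lt_q : (1 : ℝ≥0) < (Fintype.card Fq : ℝ≥0) := by
  exact_mod_cast Fintype.one_lt_card

/-- The absolute value on `K_∞` is normalised by `|θ| = q`, that is, `|x| = q ^ v(x)`. -/
instance KInfty.rankOne : Valuation.RankOne (Valued.v : Valuation (KInfty Fq) _) where
  hom' := (WithZeroMulInt.toNNReal (one_lt_q Fq).ne_zero).comp
    MonoidWithZeroHom.ValueGroup₀.embedding
  strictMono' := (WithZeroMulInt.toNNReal_strictMono (one_lt_q Fq)).comp
    MonoidWithZeroHom.ValueGroup₀.embedding_strictMono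
  exists_val_nontrivial :=
    ⟨algebraMap (RatFunc Fq) (KInfty Fq) RatFunc.X, by
      rw [KInfty.valued_coe, RatFunc.inftyValuation.X]; simp⟩

instance KInfty.normedField : NontriviallyNormedField (KInfty Fq) :=
  Valued.toNontriviallyNormedField (KInfty Fq) _

instance KInfty.completeSpace : CompleteSpace (KInfty Fq) := by
  classical
  exact inferInstanceAs (CompleteSpace
    (@UniformSpace.Completion (RatFunc Fq) (RatFunc.inftyValued Fq).toUniformSpace))

open scoped Classical in
lemma KInfty.norm_coe (x : RatFunc Fq) :
    ‖algebraMap (RatFunc Fq) (KInfty Fq) x‖ =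
      WithZeroMulInt.toNNReal (one_lt_q Fq).ne_zero (RatFunc.inftyValuation Fq x) := by
  rw [← KInfty.valued_coe]
  change ((WithZeroMulInt.toNNReal (one_lt_q Fq).ne_zero
    (MonoidWithZeroHom.ValueGroup₀.embedding (Valued.v.restrict _)) : ℝ≥0) : ℝ) = _
  rw [Valuation.embedding_restrict]

/-- An algebraic closure of `K_∞`. -/
abbrev KInftyAlg : Type _ := AlgebraicClosure (KInfty Fq)

/-- The unique extension of the absolute value of `K_∞` to the algebraic closure. -/
instance KInftyAlg.normedField : NormedField (KInftyAlg Fq) :=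
  spectralNorm.normedField (KInfty Fq) (KInftyAlg Fq)

/-- `ℂ_∞`, the completion of an algebraic closure of `K_∞`. -/
def CInfty : Type _ := UniformSpace.Completion (KInftyAlg Fq)

instance CInfty.normedField : NormedField (CInfty Fq) :=
  inferInstanceAs (NormedField (UniformSpace.Completion (KInftyAlg Fq)))

instance CInfty.completeSpace : CompleteSpace (CInfty Fq) :=
  inferInstanceAs (CompleteSpace (UniformSpace.Completion (KInftyAlg Fq)))

/-- The embedding `𝔽_q(θ) → K_∞ → K_∞^alg → ℂ_∞`. -/
def CInfty.ofRatFunc : RatFunc Fq →+* CInfty Fq :=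
  (UniformSpace.Completion.coeRingHom (α := KInftyAlg Fq)).comp
    ((algebraMap (KInfty Fq) (KInftyAlg Fq)).comp (algebraMap (RatFunc Fq) (KInfty Fq)))

instance CInfty.algebra : Algebra Fq (CInfty Fq) :=
  ((CInfty.ofRatFunc Fq).comp RatFunc.C).toAlgebra

/-- The element `θ` of `ℂ_∞`. -/
def theta : CInfty Fq := CInfty.ofRatFunc Fq RatFunc.X

open scoped Classical in
lemma CInfty.norm_ofRatFunc (x : RatFunc Fq) :
    ‖CInfty.ofRatFunc Fq x‖ =
      WithZeroMulInt.toNNReal (one_lt_q Fq).ne_zero (RatFunc.inftyValuation Fq x) := by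
  rw [← KInfty.norm_coe]
  exact (UniformSpace.Completion.norm_coe (E := KInftyAlg Fq) _).trans
    (spectralNorm_extends (K := KInfty Fq) (L := KInftyAlg Fq) _)

lemma norm_theta : ‖theta Fq‖ = Fintype.card Fq := by
  classical
  rw [theta, CInfty.norm_ofRatFunc, RatFunc.inftyValuation.X,
    WithZeroMulInt.toNNReal_neg_apply _ (by simp)]
  have : WithZero.unzero (WithZero.exp_ne_zero (a := (1 : ℤ))) = Multiplicative.ofAdd 1 := rfl
  simp [this]

instance CInfty.isUltrametricDist : IsUltrametricDist (CInfty Fq) := by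
  have h : IsUltrametricDist (UniformSpace.Completion (KInftyAlg Fq)) := by
    refine IsUltrametricDist.isUltrametricDist_of_forall_norm_add_le_max_norm fun x y => ?_
    refine UniformSpace.Completion.induction_on₂ x y ?_ ?_
    · exact isClosed_le (continuous_norm.comp (continuous_fst.add continuous_snd))
        ((continuous_norm.comp continuous_fst).max (continuous_norm.comp continuous_snd))
    · intro a b
      rw [← UniformSpace.Completion.coe_add, UniformSpace.Completion.norm_coe,
        UniformSpace.Completion.norm_coe, UniformSpace.Completion.norm_coe]
      exact isNonarchimedean_spectralNorm (K := KInfty Fq) (L := KInftyAlg Fq) a b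
  exact h

lemma one_le_norm_theta_pow_sub {n : ℕ} (hn : 0 < n) :
    1 ≤ ‖theta Fq ^ Fintype.card Fq ^ n - theta Fq‖ := by
  have hq : 2 ≤ Fintype.card Fq := Fintype.one_lt_card
  have h1 : (1 : ℝ) < Fintype.card Fq := by exact_mod_cast hq
  have h2 : 2 ≤ Fintype.card Fq ^ n := hq.trans (Nat.le_self_pow (by omega) _)
  have h3 : ‖theta Fq‖ < ‖theta Fq ^ Fintype.card Fq ^ n‖ := by
    rw [norm_pow, norm_theta]
    exact lt_self_pow₀ h1 (by omega)
  have h4 := norm_sub_rev (theta Fq ^ Fintype.card Fq ^ n) (theta Fq)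
  have h5 := IsUltrametricDist.norm_add_eq_max_of_norm_ne_norm
    (x := theta Fq ^ Fintype.card Fq ^ n) (y := -theta Fq) (by rw [norm_neg]; exact h3.ne')
  rw [← sub_eq_add_neg] at h5
  rw [h5]
  refine le_max_of_le_right ?_
  rw [norm_neg, norm_theta]
  exact h1.le

lemma theta_pow_ne {n : ℕ} (hn : 0 < n) : theta Fq ^ Fintype.card Fq ^ n ≠ theta Fq := by
  intro h
  have := one_le_norm_theta_pow_sub Fq hn
  rw [h, sub_self, norm_zero] at this
  linarith

end Fields

section WeilOperator

variable {Fq : Type*} [Field Fq]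

/-! ### The dual map and the rank-two Weil operator -/

/-- The dual map `D_𝔣` of `𝔽_q[t]/𝔣`, expressed on polynomial representatives: it depends only on
the class of its argument modulo `𝔣`, takes values in polynomials of degree less than `n = deg 𝔣`,
and `D_𝔣(t ^ i) = ∑_{j = 0}^{n - i - 1} a_{i + j + 1} t ^ j` for `0 ≤ i < n`,
where `a_k` are the coefficients of `𝔣`. -/
def dualMap (f : Fq[X]) : Fq[X] →ₗ[Fq] Fq[X] :=
  ∑ i ∈ Finset.range f.natDegree,
    ((lcoeff Fq i).comp (modByMonicHom f)).smulRight
      (∑ j ∈ Finset.range (f.natDegree - i), C (f.coeff (i + j + 1)) * X ^ j)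

lemma dualMap_X_pow {f : Fq[X]} (hf : f.Monic) {i : ℕ} (hi : i < f.natDegree) :
    dualMap f (X ^ i) =
      ∑ j ∈ Finset.range (f.natDegree - i), C (f.coeff (i + j + 1)) * X ^ j := by
  have h : (X ^ i : Fq[X]) %ₘ f = X ^ i := by
    rw [modByMonic_eq_self_iff hf, degree_X_pow, degree_eq_natDegree hf.ne_zero]
    exact_mod_cast hi
  simp only [dualMap, LinearMap.sum_apply, LinearMap.smulRight_apply, LinearMap.comp_apply,
    modByMonicHom_apply, h, lcoeff_apply, coeff_X_pow, ite_smul, one_smul, zero_smul]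
  rw [Finset.sum_ite_eq' , if_pos (Finset.mem_range.2 hi)]

/-- The rank-two Weil operator `O_𝔣^{(2)}(x, t) = ∑_{k < n} D_𝔣(x ^ k) t ^ k`, as an element of
`𝔽_q[t][x]`: the outer variable is `x`, the inner one is `t`. -/
def weilOperatorTwo (f : Fq[X]) : Fq[X][X] :=
  ∑ k ∈ Finset.range f.natDegree, (dualMap f (X ^ k)).map C * C (X ^ k)

end WeilOperator

variable {Fq : Type*} [Field Fq] [Fintype Fq]

/-! ### The Tate algebra and the `𝔣`-remainder -/

variable (Fq) in
/-- The Tate algebra `𝕋`: power series over `ℂ_∞` whose coefficients tend to zero. -/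
def tateAlgebra : Subring (PowerSeries (CInfty Fq)) := PowerSeries.IsRestricted.subring 1

lemma mem_tateAlgebra {ω : PowerSeries (CInfty Fq)} :
    ω ∈ tateAlgebra Fq ↔
      Filter.Tendsto (fun i => PowerSeries.coeff i ω) Filter.atTop (nhds 0) := by
  change PowerSeries.IsRestricted 1 ω ↔ _
  rw [PowerSeries.isRestricted_iff']
  simp [tendsto_zero_iff_norm_tendsto_zero]

/-- The quotient algebra `ℂ_∞[t]/𝔣 ℂ_∞[t]`. -/
abbrev QuotAlg (f : Fq[X]) : Type _ := AdjoinRoot (f.map (algebraMap Fq (CInfty Fq)))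

/-- The norm `‖∑_{i < n} g_i t̄ ^ i‖ = max |g_i|` on `ℂ_∞[t]/𝔣 ℂ_∞[t]`. -/
@[reducible] def QuotAlg.normed {f : Fq[X]} (hf : f.Monic) : NormedAddCommGroup (QuotAlg f) :=
  NormedAddCommGroup.induced _ _
    (AdjoinRoot.powerBasisAux' (hf.map (algebraMap Fq (CInfty Fq)))).equivFun
    (LinearEquiv.injective _)

/-- The evaluation map `ev_𝔣 : 𝕋 → ℂ_∞[t]/𝔣 ℂ_∞[t]`, `ω(t) ↦ ω(t̄) = ∑ i, c_i t̄ ^ i`. -/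
def evalMod {f : Fq[X]} (hf : f.Monic) (ω : tateAlgebra Fq) : QuotAlg f :=
  letI := QuotAlg.normed hf
  ∑' i : ℕ, PowerSeries.coeff i (ω : PowerSeries (CInfty Fq)) • AdjoinRoot.root _ ^ i

/-- The `𝔣`-remainder `[ω]_𝔣`: the polynomial of degree less than `deg 𝔣` representing `ev_𝔣(ω)`. -/
def remainder {f : Fq[X]} (hf : f.Monic) (ω : tateAlgebra Fq) : (CInfty Fq)[X] :=
  AdjoinRoot.modByMonicHom (hf.map (algebraMap Fq (CInfty Fq))) (evalMod hf ω)

/-! ### Drinfeld modules -/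

variable (Fq) in
/-- A Drinfeld `𝔽_q[x]`-module of rank `r ≥ 1` over `ℂ_∞`, given by
`φ_x = θ + g_1 τ + ⋯ + g_r τ ^ r` with `g_r ≠ 0`. -/
structure DrinfeldModule where
  /-- the rank `r` -/
  rank : ℕ
  rank_pos : 0 < rank
  /-- the coefficients `g_i`, with `g_i = 0` for `i > r` -/
  g : ℕ → CInfty Fq
  g_zero : g 0 = theta Fq
  g_rank : g rank ≠ 0
  g_of_lt : ∀ i, rank < i → g i = 0

namespace DrinfeldModule

variable (φ : DrinfeldModule Fq)

/-- The operator `φ_x = ∑_{i ≤ r} g_i τ ^ i`, where `τ` is the `q`-power Frobenius. Twisted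
polynomials in `ℂ_∞{τ}` are identified with the `𝔽_q`-linear maps `ℂ_∞ → ℂ_∞` they induce. -/
def phiX : Module.End Fq (CInfty Fq) :=
  ∑ i ∈ Finset.range (φ.rank + 1),
    LinearMap.mulLeft Fq (φ.g i) * (FiniteField.frobeniusAlgHom Fq (CInfty Fq)).toLinearMap ^ i

/-- The `𝔽_q`-algebra homomorphism `a ↦ φ_a`. -/
def phi : Fq[X] →ₐ[Fq] Module.End Fq (CInfty Fq) := aeval φ.phiX

lemma phi_X_apply (μ : CInfty Fq) :
    φ.phi X μ = ∑ i ∈ Finset.range (φ.rank + 1), φ.g i * μ ^ Fintype.card Fq ^ i := by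
  have h : ∀ i : ℕ, ((FiniteField.frobeniusAlgHom Fq (CInfty Fq)).toLinearMap ^ i) μ =
      μ ^ Fintype.card Fq ^ i := by
    intro i
    induction i with
    | zero => simp
    | succ i ih =>
      rw [pow_succ', Module.End.mul_apply, ih]
      simp [pow_succ, pow_mul]
  simp [phi, phiX, LinearMap.sum_apply, h]

/-- The Drinfeld action `P(x, t) ⋄_φ μ` on `μ ∈ ℂ_∞`, for a polynomial `P = ∑ p_k(t) x ^ k`: the
variable `x` acts through `φ` and the elements of `𝔽_q[t]` act as scalars, so that
`P ⋄_φ μ = ∑ p_k(t) φ_{x ^ k}(μ) ∈ ℂ_∞[t]`. -/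
def diamond (P : Fq[X][X]) (μ : CInfty Fq) : (CInfty Fq)[X] :=
  P.sum fun k p => p.map (algebraMap Fq (CInfty Fq)) * C (φ.phi (X ^ k) μ)

/-- The coefficients `e_n` of the exponential `exp_φ = ∑ e_n τ ^ n`, the power series in `τ` with
`e_0 = 1` and `φ_x exp_φ = exp_φ θ`. -/
def expCoeff (n : ℕ) : CInfty Fq :=
  if n = 0 then 1
  else (∑ i : Fin n, φ.g (n - i) * expCoeff i ^ Fintype.card Fq ^ (n - i : ℕ)) /
    (theta Fq ^ Fintype.card Fq ^ n - theta Fq)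
termination_by n
decreasing_by exact i.2

/-- The exponential `exp_φ(z) = ∑ e_n z ^ (q ^ n)`. -/
def exp (z : CInfty Fq) : CInfty Fq := ∑' n : ℕ, φ.expCoeff n * z ^ Fintype.card Fq ^ n

lemma expCoeff_zero : φ.expCoeff 0 = 1 := by rw [expCoeff, if_pos rfl]

/-- The defining identity `φ_x exp_φ = exp_φ θ`, coefficient by coefficient. -/
lemma expCoeff_spec (n : ℕ) :
    ∑ j ∈ Finset.range (n + 1), φ.g (n - j) * φ.expCoeff j ^ Fintype.card Fq ^ (n - j) =
      φ.expCoeff n * theta Fq ^ Fintype.card Fq ^ n := by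
  rcases Nat.eq_zero_or_pos n with rfl | hn
  · simp [φ.expCoeff_zero, φ.g_zero]
  · have h0 := sub_ne_zero.2 (theta_pow_ne Fq hn)
    have h : ∑ j ∈ Finset.range n, φ.g (n - j) * φ.expCoeff j ^ Fintype.card Fq ^ (n - j) =
        φ.expCoeff n * (theta Fq ^ Fintype.card Fq ^ n - theta Fq) := by
      conv_rhs => rw [expCoeff, if_neg hn.ne', div_mul_cancel₀ _ h0]
      exact (Fin.sum_univ_eq_sum_range (fun j => φ.g (n - j) *
        φ.expCoeff j ^ Fintype.card Fq ^ (n - j)) n).symm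
    rw [Finset.sum_range_succ, h]
    simp [φ.g_zero]
    ring

lemma exists_expCoeff_bound : ∃ R : ℝ, 1 ≤ R ∧ ∀ n, ‖φ.expCoeff n‖ ≤ R ^ Fintype.card Fq ^ n := by
  have hq : 2 ≤ Fintype.card Fq := Fintype.one_lt_card
  obtain ⟨R, hR1, hR⟩ : ∃ R : ℝ, 1 ≤ R ∧ ∀ j, ‖φ.g j‖ ≤ R := by
    refine ⟨1 + ∑ j ∈ Finset.range (φ.rank + 1), ‖φ.g j‖, ?_, fun j => ?_⟩
    · have := Finset.sum_nonneg (fun j (_ : j ∈ Finset.range (φ.rank + 1)) => norm_nonneg (φ.g j))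
      linarith
    · by_cases hj : j ≤ φ.rank
      · have := Finset.single_le_sum (f := fun j => ‖φ.g j‖) (fun j _ => norm_nonneg _)
          (Finset.mem_range.2 (Nat.lt_succ_of_le hj))
        linarith
      · rw [φ.g_of_lt j (by omega), norm_zero]
        exact add_nonneg zero_le_one (Finset.sum_nonneg fun _ _ => norm_nonneg _)
  have hR0 : 0 ≤ R := zero_le_one.trans hR1
  suffices h : ∀ n, ‖φ.expCoeff n‖ ≤ R ^ (Fintype.card Fq ^ n - 1) from
    ⟨R, hR1, fun n => (h n).trans (pow_le_pow_right₀ hR1 (Nat.sub_le _ _))⟩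
  intro n
  induction n using Nat.strong_induction_on with
  | _ n ih =>
    rcases Nat.eq_zero_or_pos n with rfl | hn
    · simp [φ.expCoeff_zero]
    · rw [expCoeff, if_neg hn.ne', norm_div]
      refine (div_le_self (norm_nonneg _) ?_).trans ?_
      · exact one_le_norm_theta_pow_sub Fq hn
      · refine IsUltrametricDist.norm_sum_le_of_forall_le_of_nonneg (pow_nonneg hR0 _) ?_
        intro i _
        rw [norm_mul, norm_pow]
        calc ‖φ.g (n - i)‖ * ‖φ.expCoeff i‖ ^ Fintype.card Fq ^ (n - i : ℕ)
            ≤ R * (R ^ (Fintype.card Fq ^ (i : ℕ) - 1)) ^ Fintype.card Fq ^ (n - i : ℕ) := by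
              gcongr
              · exact hR _
              · exact ih i i.2
          _ = R ^ (1 + (Fintype.card Fq ^ (i : ℕ) - 1) * Fintype.card Fq ^ (n - i : ℕ)) := by
              rw [pow_add, pow_one, ← pow_mul]
          _ ≤ R ^ (Fintype.card Fq ^ n - 1) := by
              refine pow_le_pow_right₀ hR1 ?_
              have e : Fintype.card Fq ^ n =
                  Fintype.card Fq ^ (i : ℕ) * Fintype.card Fq ^ (n - i : ℕ) := by
                rw [← pow_add]; congr 1; omega
              have h2 : 2 ≤ Fintype.card Fq ^ (n - i : ℕ) :=
                hq.trans (Nat.le_self_pow (by omega) _)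
              have h3 : 1 ≤ Fintype.card Fq ^ (i : ℕ) := Nat.one_le_pow _ _ (by omega)
              rw [e, Nat.sub_mul, one_mul]
              have := Nat.mul_le_mul h3 (le_refl (Fintype.card Fq ^ (n - i : ℕ)))
              omega

lemma tendsto_exp {w : ℕ → CInfty Fq} (hw : Filter.Tendsto w Filter.atTop (nhds 0)) :
    Filter.Tendsto (fun k => φ.exp (w k)) Filter.atTop (nhds 0) := by
  obtain ⟨R, hR1, hR⟩ := φ.exists_expCoeff_bound
  have hR0 : 0 ≤ R := zero_le_one.trans hR1
  have hw' : Filter.Tendsto (fun k => R * ‖w k‖) Filter.atTop (nhds 0) := by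
    simpa using (tendsto_zero_iff_norm_tendsto_zero.1 hw).const_mul R
  refine squeeze_zero_norm' ?_ hw'
  filter_upwards [hw'.eventually (gt_mem_nhds zero_lt_one)] with k hk
  refine IsUltrametricDist.norm_tsum_le_of_forall_le_of_nonneg (by positivity) fun n => ?_
  rw [norm_mul, norm_pow]
  calc ‖φ.expCoeff n‖ * ‖w k‖ ^ Fintype.card Fq ^ n
      ≤ R ^ Fintype.card Fq ^ n * ‖w k‖ ^ Fintype.card Fq ^ n := by gcongr; exact hR n
    _ = (R * ‖w k‖) ^ Fintype.card Fq ^ n := (mul_pow _ _ _).symm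
    _ ≤ R * ‖w k‖ := pow_le_of_le_one (by positivity) hk.le
        (pow_ne_zero _ Fintype.card_ne_zero)

/-- The lattice of `φ`: the kernel of `exp_φ`. -/
def lattice : Set (CInfty Fq) := {z | φ.exp z = 0}

lemma omega_mem (z : CInfty Fq) :
    PowerSeries.mk (fun k => φ.exp (z / theta Fq ^ (k + 1))) ∈ tateAlgebra Fq := by
  rw [mem_tateAlgebra]
  simp only [PowerSeries.coeff_mk]
  refine φ.tendsto_exp ?_
  have h : ‖(theta Fq)⁻¹‖ < 1 := by
    rw [norm_inv, norm_theta]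
    exact inv_lt_one_of_one_lt₀ (by exact_mod_cast Fintype.one_lt_card)
  have := ((tendsto_pow_atTop_nhds_zero_of_norm_lt_one h).comp
    (Filter.tendsto_add_atTop_nat 1)).const_mul z
  simpa [div_eq_mul_inv, Function.comp_def] using this

/-- The Anderson generating function `ω_z(t) = ∑ k, exp_φ(z / θ ^ (k + 1)) t ^ k`. -/
def omega (z : CInfty Fq) : tateAlgebra Fq :=
  ⟨PowerSeries.mk fun k => φ.exp (z / theta Fq ^ (k + 1)), φ.omega_mem z⟩

end DrinfeldModule

end DrinfeldWeil

end

open DrinfeldWeil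

/-!
The exponential `exp_φ` is a continuous `𝔽_q`-linear map satisfying
`exp_φ(a(θ) w) = φ_a(exp_φ(w))` for `a ∈ 𝔽_q[x]` (`expLinear`, `continuous_expLinear`,
`exp_aeval_theta_mul`). The Anderson generating function is therefore the coefficientwise image
under `exp_φ` of the geometric series `z / (θ - t) = ∑ z t ^ k / θ ^ (k + 1)`. Reduction modulo `𝔣`
is, in each coordinate, an infinite linear combination of the coefficients with scalars in `𝔽_q`,
so it commutes with `exp_φ` (`coeff_remainder_omega`).

Since `𝔣(θ) - 𝔣(t) = (θ - t) ∑_{i < n} D_𝔣(x ^ i)(θ) t ^ i`, the reduction of `1 / (θ - t)` modulo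
`𝔣` is `∑_{i < n} (D_𝔣(x ^ i)(θ) / 𝔣(θ)) t ^ i` (`hasSum_coeff_X_pow_modByMonic`). Hence the
coefficient of `t ^ i` in the remainder is
`exp_φ(D_𝔣(x ^ i)(θ) z / 𝔣(θ)) = φ_{D_𝔣(x ^ i)}(exp_φ(z / 𝔣(θ)))`. For `i = n - 1` the polynomial
`D_𝔣(x ^ i)` is `1`, which identifies the top coefficient with `exp_φ(z / 𝔣(θ))`.

The analytic input is that the series `exp_φ` converges everywhere, which follows from the
superexponential decay of its coefficients (`exists_expCoeff_decay`).
-/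

open DrinfeldWeil

noncomputable section

namespace DrinfeldWeil

variable {Fq : Type*} [Field Fq] [Fintype Fq]

/-! ### Scalars and the Frobenius on `ℂ_∞` -/

lemma norm_algebraMap_le_one (c : Fq) : ‖algebraMap Fq (CInfty Fq) c‖ ≤ 1 := by
  rcases eq_or_ne c 0 with rfl | hc
  · simp
  · have h : (algebraMap Fq (CInfty Fq) c) ^ (Fintype.card Fq - 1) = 1 := by
      rw [← map_pow, FiniteField.pow_card_sub_one_eq_one c hc, map_one]
    have hq : Fintype.card Fq - 1 ≠ 0 := by
      have : 1 < Fintype.card Fq := Fintype.one_lt_card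
      omega
    have h' := congrArg norm h
    rw [norm_pow, norm_one] at h'
    exact ((pow_eq_one_iff_of_nonneg (norm_nonneg _) hq).1 h').le

lemma norm_smul_le_norm (c : Fq) (w : CInfty Fq) : ‖c • w‖ ≤ ‖w‖ := by
  rw [Algebra.smul_def, norm_mul]
  exact mul_le_of_le_one_left (norm_nonneg _) (norm_algebraMap_le_one c)

lemma frobenius_pow_apply (j : ℕ) (w : CInfty Fq) :
    ((FiniteField.frobeniusAlgHom Fq (CInfty Fq)).toLinearMap ^ j) w =
      w ^ Fintype.card Fq ^ j := by
  induction j with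
  | zero => simp
  | succ j ih =>
    rw [pow_succ', Module.End.mul_apply, ih]
    simp [pow_succ, pow_mul]

lemma add_pow_card_pow (j : ℕ) (v w : CInfty Fq) :
    (v + w) ^ Fintype.card Fq ^ j = v ^ Fintype.card Fq ^ j + w ^ Fintype.card Fq ^ j := by
  simp only [← frobenius_pow_apply, map_add]

lemma smul_pow_card_pow (j : ℕ) (c : Fq) (w : CInfty Fq) :
    (c • w) ^ Fintype.card Fq ^ j = c • w ^ Fintype.card Fq ^ j := by
  simp only [← frobenius_pow_apply, map_smul]

lemma hasSum_pow_card_pow {u : ℕ → CInfty Fq} {s : CInfty Fq} (h : HasSum u s) (j : ℕ) :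
    HasSum (fun n => u n ^ Fintype.card Fq ^ j) (s ^ Fintype.card Fq ^ j) := by
  have hc : Continuous
      ((FiniteField.frobeniusAlgHom Fq (CInfty Fq)).toLinearMap ^ j : Module.End Fq _) := by
    simp only [funext (frobenius_pow_apply (Fq := Fq) j)]
    exact continuous_pow _
  simpa only [Function.comp_def, frobenius_pow_apply] using h.map _ hc

lemma aeval_theta_ne_zero {f : Fq[X]} (hf : f ≠ 0) : aeval (theta Fq) f ≠ 0 := by
  have h : aeval (theta Fq) f = CInfty.ofRatFunc Fq (algebraMap Fq[X] (RatFunc Fq) f) := by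
    rw [theta, ← RatFunc.algebraMap_X]
    exact (congrFun (congrArg DFunLike.coe (Polynomial.algHom_ext (R := Fq)
      (f := aeval (CInfty.ofRatFunc Fq (algebraMap Fq[X] (RatFunc Fq) X)))
      (g := ⟨(CInfty.ofRatFunc Fq).comp (algebraMap Fq[X] (RatFunc Fq)), fun _ => rfl⟩)
      (aeval_X _))) f)
  rw [h, _root_.map_ne_zero]
  exact RatFunc.algebraMap_ne_zero hf

lemma summable_of_tendsto_zero {u : ℕ → CInfty Fq}
    (hu : Filter.Tendsto u Filter.atTop (nhds 0)) : Summable u :=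
  NonarchimedeanAddGroup.summable_of_tendsto_cofinite_zero (Nat.cofinite_eq_atTop ▸ hu)

/-! ### The exponential of a Drinfeld module -/

namespace DrinfeldModule

variable (φ : DrinfeldModule Fq)

/-- Superexponential decay `‖e_n‖ ^ (1 / q ^ n) = O(D ^ (-n))` with `D > 1`, which makes `exp_φ`
entire. In the recursion for `e_n` the division by `θ ^ (q ^ n) - θ` gains a factor `q ^ (q ^ n)`,
while passing from `e_{n - j}`, `j ≤ r`, to `e_n` costs at most `D ^ (r q ^ n)`. -/
lemma exists_expCoeff_decay : ∃ R D : ℝ, 1 ≤ R ∧ 1 < D ∧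
    ∀ n, ‖φ.expCoeff n‖ * (D ^ n) ^ Fintype.card Fq ^ n ≤ R ^ Fintype.card Fq ^ n := by
  have hq : 2 ≤ Fintype.card Fq := Fintype.one_lt_card
  have hq1 : (1 : ℝ) < Fintype.card Fq := by exact_mod_cast hq
  obtain ⟨D, hD1, hD⟩ : ∃ D : ℝ, 1 < D ∧ D ^ φ.rank ≤ Fintype.card Fq := by
    refine ⟨(Fintype.card Fq : ℝ) ^ ((φ.rank : ℝ)⁻¹), ?_, ?_⟩
    · exact Real.one_lt_rpow hq1 (inv_pos.2 (by exact_mod_cast φ.rank_pos))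
    · rw [Real.rpow_inv_natCast_pow (by positivity) φ.rank_pos.ne']
  obtain ⟨R, hR1, hR⟩ : ∃ R : ℝ, 1 ≤ R ∧ ∀ j, ‖φ.g j‖ ≤ R := by
    refine ⟨1 + ∑ j ∈ Finset.range (φ.rank + 1), ‖φ.g j‖, ?_, fun j => ?_⟩
    · have := Finset.sum_nonneg (fun j (_ : j ∈ Finset.range (φ.rank + 1)) => norm_nonneg (φ.g j))
      linarith
    · by_cases hj : j ≤ φ.rank
      · have := Finset.single_le_sum (f := fun j => ‖φ.g j‖) (fun j _ => norm_nonneg _)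
          (Finset.mem_range.2 (Nat.lt_succ_of_le hj))
        linarith
      · rw [φ.g_of_lt j (by omega), norm_zero]
        exact add_nonneg zero_le_one (Finset.sum_nonneg fun _ _ => norm_nonneg _)
  have hR0 : 0 ≤ R := zero_le_one.trans hR1
  have hD0 : 0 < D := zero_lt_one.trans hD1
  -- The exponent `q ^ n - 1` leaves room in the induction for the factor `‖g_j‖ ≤ R`.
  suffices h : ∀ n, ‖φ.expCoeff n‖ * (D ^ n) ^ Fintype.card Fq ^ n ≤
      R ^ (Fintype.card Fq ^ n - 1) from
    ⟨R, D, hR1, hD1, fun n => (h n).trans (pow_le_pow_right₀ hR1 (Nat.sub_le _ _))⟩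
  intro n
  induction n using Nat.strong_induction_on with
  | _ n ih =>
    rcases Nat.eq_zero_or_pos n with rfl | hn
    · simp [φ.expCoeff_zero]
    have hθ : ‖theta Fq ^ Fintype.card Fq ^ n - theta Fq‖ =
        (Fintype.card Fq : ℝ) ^ Fintype.card Fq ^ n := by
      have h2 : 2 ≤ Fintype.card Fq ^ n := hq.trans (Nat.le_self_pow (by omega) _)
      have h3 : ‖theta Fq‖ < ‖theta Fq ^ Fintype.card Fq ^ n‖ := by
        rw [norm_pow, norm_theta]
        exact lt_self_pow₀ hq1 (by omega)
      have h5 := IsUltrametricDist.norm_add_eq_max_of_norm_ne_norm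
        (x := theta Fq ^ Fintype.card Fq ^ n) (y := -theta Fq) (by rw [norm_neg]; exact h3.ne')
      rw [sub_eq_add_neg, h5, norm_neg, max_eq_left h3.le, norm_pow, norm_theta]
    have hpos : 0 < (D ^ n) ^ Fintype.card Fq ^ n := by positivity
    rw [← le_div_iff₀ hpos, expCoeff, if_neg hn.ne', norm_div, hθ, div_le_iff₀ (by positivity)]
    refine IsUltrametricDist.norm_sum_le_of_forall_le_of_nonneg (by positivity) ?_
    intro i _
    by_cases hj : φ.rank < n - i
    · rw [φ.g_of_lt _ hj, zero_mul, norm_zero]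
      positivity
    rw [not_lt] at hj
    have hi : (i : ℕ) < n := i.2
    have e : Fintype.card Fq ^ n =
        Fintype.card Fq ^ (i : ℕ) * Fintype.card Fq ^ (n - i : ℕ) := by
      rw [← pow_add]; congr 1; omega
    have hDj : (D ^ n) ≤ D ^ (i : ℕ) * Fintype.card Fq := by
      calc D ^ n = D ^ (i : ℕ) * D ^ (n - i : ℕ) := by rw [← pow_add]; congr 1; omega
        _ ≤ D ^ (i : ℕ) * Fintype.card Fq := by
          gcongr
          exact (pow_le_pow_right₀ hD1.le hj).trans hD
    rw [norm_mul, norm_pow, div_mul_eq_mul_div, le_div_iff₀ hpos]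
    calc ‖φ.g (n - i)‖ * ‖φ.expCoeff i‖ ^ Fintype.card Fq ^ (n - i : ℕ) *
          (D ^ n) ^ Fintype.card Fq ^ n
        ≤ R * ‖φ.expCoeff i‖ ^ Fintype.card Fq ^ (n - i : ℕ) *
          (D ^ (i : ℕ) * Fintype.card Fq) ^ Fintype.card Fq ^ n := by
          gcongr
          exact hR _
      _ = R * (‖φ.expCoeff i‖ * (D ^ (i : ℕ)) ^ Fintype.card Fq ^ (i : ℕ)) ^
            Fintype.card Fq ^ (n - i : ℕ) * (Fintype.card Fq : ℝ) ^ Fintype.card Fq ^ n := by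
          rw [mul_pow, mul_pow, e, pow_mul (D ^ (i : ℕ))]
          ring
      _ ≤ R * (R ^ (Fintype.card Fq ^ (i : ℕ) - 1)) ^ Fintype.card Fq ^ (n - i : ℕ) *
            (Fintype.card Fq : ℝ) ^ Fintype.card Fq ^ n := by
          gcongr
          exact ih i hi
      _ = R ^ (1 + (Fintype.card Fq ^ (i : ℕ) - 1) * Fintype.card Fq ^ (n - i : ℕ)) *
            (Fintype.card Fq : ℝ) ^ Fintype.card Fq ^ n := by
          rw [pow_add, pow_one, ← pow_mul]
      _ ≤ R ^ (Fintype.card Fq ^ n - 1) * (Fintype.card Fq : ℝ) ^ Fintype.card Fq ^ n := by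
          refine mul_le_mul_of_nonneg_right (pow_le_pow_right₀ hR1 ?_) (by positivity)
          have h2 : 2 ≤ Fintype.card Fq ^ (n - i : ℕ) :=
            hq.trans (Nat.le_self_pow (by omega) _)
          have h3 : 1 ≤ Fintype.card Fq ^ (i : ℕ) := Nat.one_le_pow _ _ (by omega)
          rw [e, Nat.sub_mul, one_mul]
          have := Nat.mul_le_mul h3 (le_refl (Fintype.card Fq ^ (n - i : ℕ)))
          omega

lemma hasSum_exp (z : CInfty Fq) :
    HasSum (fun n => φ.expCoeff n * z ^ Fintype.card Fq ^ n) (φ.exp z) := by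
  refine (summable_of_tendsto_zero ?_).hasSum
  obtain ⟨R, D, hR1, hD1, h⟩ := φ.exists_expCoeff_decay
  have hR0 : 0 ≤ R := zero_le_one.trans hR1
  have hD0 : 0 < D := zero_lt_one.trans hD1
  have hlim : Filter.Tendsto (fun n => R * ‖z‖ * D⁻¹ ^ n) Filter.atTop (nhds 0) := by
    simpa using (tendsto_pow_atTop_nhds_zero_of_lt_one (inv_nonneg.2 hD0.le)
      (inv_lt_one_of_one_lt₀ hD1)).const_mul (R * ‖z‖)
  refine squeeze_zero_norm' ?_ hlim
  filter_upwards [hlim.eventually (gt_mem_nhds zero_lt_one)] with n hn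
  have hn' : ‖φ.expCoeff n‖ ≤ (R * D⁻¹ ^ n) ^ Fintype.card Fq ^ n := by
    rw [inv_pow, ← div_eq_mul_inv, div_pow, le_div_iff₀ (by positivity)]
    exact h n
  rw [norm_mul, norm_pow]
  calc ‖φ.expCoeff n‖ * ‖z‖ ^ Fintype.card Fq ^ n
      ≤ (R * D⁻¹ ^ n) ^ Fintype.card Fq ^ n * ‖z‖ ^ Fintype.card Fq ^ n := by gcongr
    _ = (R * ‖z‖ * D⁻¹ ^ n) ^ Fintype.card Fq ^ n := by rw [← mul_pow]; ring
    _ ≤ R * ‖z‖ * D⁻¹ ^ n := pow_le_of_le_one (by positivity) hn.le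
        (pow_ne_zero _ Fintype.card_ne_zero)

/-- The exponential as an `𝔽_q`-linear endomorphism of `ℂ_∞`. -/
def expLinear : Module.End Fq (CInfty Fq) where
  toFun := φ.exp
  map_add' v w := by
    refine (φ.hasSum_exp (v + w)).unique ?_
    simpa only [add_pow_card_pow, mul_add] using (φ.hasSum_exp v).add (φ.hasSum_exp w)
  map_smul' c w := by
    refine (φ.hasSum_exp (c • w)).unique ?_
    have h := (φ.hasSum_exp w).mul_left (algebraMap Fq (CInfty Fq) c)
    simp only [← Algebra.smul_def] at h
    simpa only [smul_pow_card_pow, mul_smul_comm, RingHom.id_apply] using h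

@[simp] lemma expLinear_apply (w : CInfty Fq) : φ.expLinear w = φ.exp w := rfl

lemma continuous_expLinear : Continuous φ.expLinear := by
  refine continuous_of_continuousAt_zero φ.expLinear ?_
  rw [ContinuousAt, map_zero, Filter.tendsto_iff_seq_tendsto]
  exact fun w hw => φ.tendsto_exp hw

/-- The functional equation `exp_φ(θ w) = φ_x(exp_φ(w))`. -/
lemma exp_theta_mul (w : CInfty Fq) : φ.exp (theta Fq * w) = φ.phi X (φ.exp w) := by
  set q := Fintype.card Fq
  -- The term of `φ_x ∘ exp_φ` of degree `q ^ n` coming from the coefficient `g_j` of `φ_x`.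
  let h : ℕ → ℕ → CInfty Fq := fun j n =>
    if j ≤ n then φ.g j * (φ.expCoeff (n - j) * w ^ q ^ (n - j)) ^ q ^ j else 0
  have hh : ∀ j, HasSum (h j) (φ.g j * φ.exp w ^ q ^ j) := by
    intro j
    have h1 := (hasSum_pow_card_pow (φ.hasSum_exp w) j).mul_left (φ.g j)
    have h0 : ∑ i ∈ Finset.range j, h j i = 0 :=
      Finset.sum_eq_zero fun i hi => if_neg (not_le.2 (Finset.mem_range.1 hi))
    have h2 := hasSum_nat_add_iff (f := h j) (g := φ.g j * φ.exp w ^ q ^ j) j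
    rw [h0, add_zero] at h2
    refine h2.1 ?_
    simpa [h] using h1
  rw [phi_X_apply]
  refine (φ.hasSum_exp _).unique ?_
  convert hasSum_sum fun j (_ : j ∈ Finset.range (φ.rank + 1)) => hh j using 1
  funext n
  have hterm : ∀ j ≤ n, h j n = φ.g j * φ.expCoeff (n - j) ^ q ^ j * w ^ q ^ n := by
    intro j hj
    simp only [h]
    rw [if_pos hj, mul_pow, ← pow_mul, ← pow_add, Nat.sub_add_cancel hj, mul_assoc]
  -- Both `j ≤ r` and `j ≤ n` may be imposed on the index, as `g_j = 0` for `j > r`.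
  have hswap : ∑ j ∈ Finset.range (φ.rank + 1), h j n = ∑ j ∈ Finset.range (n + 1), h j n := by
    have h1 : Finset.range (φ.rank + 1) ⊆ Finset.range (φ.rank + 1 + (n + 1)) :=
      Finset.range_mono (Nat.le_add_right _ _)
    have h2 : Finset.range (n + 1) ⊆ Finset.range (φ.rank + 1 + (n + 1)) :=
      Finset.range_mono (Nat.le_add_left _ _)
    rw [Finset.sum_subset h1, Finset.sum_subset h2]
    · intro j _ hj
      exact if_neg fun hjn => hj (Finset.mem_range.2 (by omega))
    · intro j _ hj
      simp [h, φ.g_of_lt j (by rw [Finset.mem_range] at hj; omega)]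
  rw [hswap, ← Finset.sum_range_reflect, mul_pow, ← mul_assoc, ← φ.expCoeff_spec, Finset.sum_mul]
  refine Finset.sum_congr rfl fun j hj => ?_
  have hj' := Finset.mem_range.1 hj
  rw [hterm _ (by omega), show n + 1 - 1 - j = n - j by omega, show n - (n - j) = j by omega]

lemma exp_aeval_theta_mul (a : Fq[X]) (w : CInfty Fq) :
    φ.exp (aeval (theta Fq) a * w) = φ.phi a (φ.exp w) := by
  induction a using Polynomial.induction_on' with
  | add a b ha hb =>
    rw [map_add, add_mul, map_add, LinearMap.add_apply, ← ha, ← hb]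
    exact φ.expLinear.map_add _ _
  | monomial n c =>
    rw [← smul_X_eq_monomial, map_smul, map_smul, LinearMap.smul_apply, smul_mul_assoc]
    refine (φ.expLinear.map_smul _ _).trans (congrArg (c • ·) ?_)
    rw [expLinear_apply, map_pow, map_pow, aeval_X]
    induction n with
    | zero => simp
    | succ n ih => rw [pow_succ', mul_assoc, exp_theta_mul, ih, pow_succ', Module.End.mul_apply]

end DrinfeldModule

/-! ### The remainder of the geometric series and of power series -/

/-- Termwise reduction of `1 / (θ - t) = ∑ t ^ k / θ ^ (k + 1)` modulo `𝔣`: the coefficient of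
`t ^ i` is `D_𝔣(x ^ i)(θ) / 𝔣(θ)`. -/
lemma hasSum_coeff_X_pow_modByMonic {f : Fq[X]} (hf : f.Monic) {i : ℕ} (hi : i < f.natDegree) :
    HasSum (fun k => (X ^ k %ₘ f).coeff i • (theta Fq ^ (k + 1))⁻¹)
      (aeval (theta Fq) (dualMap f (X ^ i)) / aeval (theta Fq) f) := by
  have hθ : theta Fq ≠ 0 := by
    rw [← norm_ne_zero_iff, norm_theta]
    exact_mod_cast Fintype.card_ne_zero
  set r : ℕ → Fq := fun k => (X ^ k %ₘ f).coeff i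
  have hs : Summable fun k => r k • (theta Fq ^ (k + 1))⁻¹ := by
    refine summable_of_tendsto_zero (squeeze_zero_norm (fun k => norm_smul_le_norm _ _) ?_)
    have h : ‖(theta Fq)⁻¹‖ < 1 := by
      rw [norm_inv, norm_theta]
      exact inv_lt_one_of_one_lt₀ (by exact_mod_cast Fintype.one_lt_card)
    simpa using ((tendsto_pow_atTop_nhds_zero_of_norm_lt_one h).comp
      (Filter.tendsto_add_atTop_nat 1)).norm
  obtain ⟨S, hS⟩ := hs
  have hr : ∀ l ≤ f.natDegree - 1, r l = if l = i then 1 else 0 := by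
    intro l hl
    have : (X ^ l : Fq[X]) %ₘ f = X ^ l := by
      rw [modByMonic_eq_self_iff hf, degree_X_pow, degree_eq_natDegree hf.ne_zero]
      exact_mod_cast (by omega : l < f.natDegree)
    simp only [r, this, coeff_X_pow, eq_comm]
  -- Shifting the index by `m` multiplies the sum by `θ ^ m`, up to the first `m` terms.
  have hshift : ∀ m ≤ f.natDegree, HasSum (fun k => r (k + m) • (theta Fq ^ (k + 1))⁻¹)
      (theta Fq ^ m * S - if i < m then theta Fq ^ (m - (i + 1)) else 0) := by
    intro m hm
    have h1 := ((hasSum_nat_add_iff' m).2 hS).mul_left (theta Fq ^ m)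
    have h2 : ∑ l ∈ Finset.range m, r l • (theta Fq ^ (l + 1))⁻¹ =
        if i < m then (theta Fq ^ (i + 1))⁻¹ else 0 := by
      rw [Finset.sum_congr rfl fun l hl => by
        rw [hr l (by have := Finset.mem_range.1 hl; omega), ite_smul, one_smul, zero_smul]]
      rw [Finset.sum_ite_eq']
      simp
    rw [h2, mul_sub] at h1
    have hterm : ∀ k, r (k + m) • (theta Fq ^ (k + 1))⁻¹ =
        theta Fq ^ m * r (k + m) • (theta Fq ^ (k + m + 1))⁻¹ := fun k => by
      rw [mul_smul_comm, show k + m + 1 = m + (k + 1) by ring, pow_add _ m, mul_inv,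
        mul_inv_cancel_left₀ (pow_ne_zero _ hθ)]
    have hfirst : (if i < m then theta Fq ^ (m - (i + 1)) else 0) =
        theta Fq ^ m * if i < m then (theta Fq ^ (i + 1))⁻¹ else 0 := by
      split_ifs with him
      · rw [pow_sub₀ _ hθ (by omega)]
      · rw [mul_zero]
    simp only [hterm, hfirst]
    exact h1
  -- The combination of these shifts with the coefficients of `𝔣` vanishes, as `𝔣 ∣ t ^ k 𝔣`.
  have hcomb : HasSum (fun _ : ℕ => (0 : CInfty Fq))
      (∑ m ∈ Finset.range (f.natDegree + 1), algebraMap Fq (CInfty Fq) (f.coeff m) *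
        (theta Fq ^ m * S - if i < m then theta Fq ^ (m - (i + 1)) else 0)) := by
    have hsum := hasSum_sum fun m (hm : m ∈ Finset.range (f.natDegree + 1)) =>
      (hshift m (by have := Finset.mem_range.1 hm; omega)).mul_left
        (algebraMap Fq (CInfty Fq) (f.coeff m))
    refine (funext fun k => ?_ : (fun _ : ℕ => (0 : CInfty Fq)) = _) ▸ hsum
    have h0 : ∑ m ∈ Finset.range (f.natDegree + 1), f.coeff m * r (k + m) = 0 := by
      have h1 : (lcoeff Fq i).comp (modByMonicHom f) (X ^ k * f) = 0 := by
        simp [(modByMonic_eq_zero_iff_dvd hf).2 (dvd_mul_left f (X ^ k))]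
      have hf' : X ^ k * f =
          ∑ m ∈ Finset.range (f.natDegree + 1), X ^ k * monomial m (f.coeff m) := by
        rw [← Finset.mul_sum, ← f.as_sum_range' (f.natDegree + 1) (Nat.lt_succ_self _)]
      rw [hf', map_sum] at h1
      rw [← h1]
      refine Finset.sum_congr rfl fun m _ => ?_
      rw [← smul_X_eq_monomial, mul_smul_comm, map_smul, ← pow_add]
      rfl
    rw [← zero_smul Fq ((theta Fq ^ (k + 1))⁻¹), ← h0, Finset.sum_smul]
    exact Finset.sum_congr rfl fun m _ => by rw [mul_smul, Algebra.smul_def]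
  have hz := hcomb.unique hasSum_zero
  have hD : ∑ m ∈ Finset.range (f.natDegree + 1), algebraMap Fq (CInfty Fq) (f.coeff m) *
      (if i < m then theta Fq ^ (m - (i + 1)) else 0) =
      aeval (theta Fq) (dualMap f (X ^ i)) := by
    obtain ⟨d, hd⟩ : ∃ d, f.natDegree = i + d := ⟨f.natDegree - i, by omega⟩
    rw [dualMap_X_pow hf hi, map_sum, hd, show i + d + 1 = (i + 1) + d by ring,
      Finset.sum_range_add, Finset.sum_eq_zero, zero_add, Nat.add_sub_cancel_left]
    · refine Finset.sum_congr rfl fun j _ => ?_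
      rw [if_pos (by omega), Nat.add_sub_cancel_left, map_mul, map_pow, aeval_C, aeval_X,
        add_right_comm]
    · intro m hm
      rw [if_neg (by have := Finset.mem_range.1 hm; omega), mul_zero]
  have hfS : aeval (theta Fq) f * S = aeval (theta Fq) (dualMap f (X ^ i)) := by
    rw [← hD, aeval_eq_sum_range, Finset.sum_mul, ← sub_eq_zero, ← Finset.sum_sub_distrib]
    refine (Finset.sum_congr rfl fun m _ => ?_).trans hz
    rw [Algebra.smul_def]
    ring
  rwa [← hfS, mul_div_cancel_left₀ _ (aeval_theta_ne_zero hf.ne_zero)]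

lemma modByMonicHom_root_pow {f : Fq[X]} (hf : f.Monic) (k : ℕ) :
    AdjoinRoot.modByMonicHom (hf.map (algebraMap Fq (CInfty Fq))) (AdjoinRoot.root _ ^ k) =
      (X ^ k %ₘ f).map (algebraMap Fq (CInfty Fq)) := by
  rw [← AdjoinRoot.mk_X, ← map_pow, AdjoinRoot.modByMonicHom_mk, map_modByMonic _ hf,
    Polynomial.map_pow, map_X]

lemma coeff_remainder_of_natDegree_le {f : Fq[X]} (hf : f.Monic) (ω : tateAlgebra Fq) {i : ℕ}
    (hi : f.natDegree ≤ i) : (remainder hf ω).coeff i = 0 := by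
  obtain ⟨p, hp⟩ := AdjoinRoot.mk_surjective (evalMod hf ω)
  rw [remainder, ← hp, AdjoinRoot.modByMonicHom_mk]
  refine coeff_eq_zero_of_degree_lt ((degree_modByMonic_lt _ (hf.map _)).trans_le ?_)
  rw [degree_eq_natDegree (hf.map _).ne_zero, hf.natDegree_map]
  exact_mod_cast hi

/-- The series defining `ω(t̄)` may be summed coordinate by coordinate. -/
lemma coeff_remainder_eq {f : Fq[X]} (hf : f.Monic) (ω : tateAlgebra Fq) (s : ℕ → CInfty Fq)
    (hs : ∀ i < f.natDegree, HasSum (fun k => (X ^ k %ₘ f).coeff i •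
      PowerSeries.coeff k (ω : PowerSeries (CInfty Fq))) (s i)) {i : ℕ} (hi : i < f.natDegree) :
    (remainder hf ω).coeff i = s i := by
  let := QuotAlg.normed hf
  set e := (AdjoinRoot.powerBasisAux' (hf.map (algebraMap Fq (CInfty Fq)))).equivFun
  have hdeg : (f.map (algebraMap Fq (CInfty Fq))).natDegree = f.natDegree := hf.natDegree_map _
  have hcoord : ∀ (v : QuotAlg f) j, e v j =
      (AdjoinRoot.modByMonicHom (hf.map (algebraMap Fq (CInfty Fq))) v).coeff j := fun _ _ => rfl
  have hind : Topology.IsInducing e := ⟨rfl⟩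
  have hsum : HasSum (fun k => PowerSeries.coeff k (ω : PowerSeries (CInfty Fq)) •
      (AdjoinRoot.root _ ^ k : QuotAlg f)) (e.symm fun j => s j) := by
    rw [← hind.hasSum_iff (g := e), e.apply_symm_apply, Pi.hasSum]
    intro j
    convert hs j (hdeg ▸ j.2) using 2 with k
    rw [Function.comp_apply, map_smul, Pi.smul_apply, hcoord, modByMonicHom_root_pow hf, coeff_map,
      smul_eq_mul, mul_comm, ← Algebra.smul_def]
  have hev : evalMod hf ω = e.symm fun j => s j := hsum.tsum_eq
  have := hcoord (evalMod hf ω) ⟨i, hdeg.symm ▸ hi⟩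
  rw [hev, e.apply_symm_apply] at this
  rw [remainder, hev, ← this]

namespace DrinfeldModule

variable (φ : DrinfeldModule Fq)

/-- The reduction of `∑ exp_φ(z / θ ^ (k + 1)) t ^ k` modulo `𝔣` is the image under `exp_φ` of the
reduction of the geometric series `z / (θ - t) = ∑ z t ^ k / θ ^ (k + 1)`. -/
lemma coeff_remainder_omega {f : Fq[X]} (hf : f.Monic) (z : CInfty Fq) {i : ℕ}
    (hi : i < f.natDegree) :
    (remainder hf (φ.omega z)).coeff i =
      φ.phi (dualMap f (X ^ i)) (φ.exp (z / aeval (theta Fq) f)) := by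
  refine coeff_remainder_eq hf (φ.omega z)
    (fun i => φ.phi (dualMap f (X ^ i)) (φ.exp (z / aeval (theta Fq) f))) (fun i hi => ?_) hi
  have h := ((hasSum_coeff_X_pow_modByMonic hf hi).mul_right z).map φ.expLinear
    φ.continuous_expLinear
  rw [expLinear_apply, div_mul_eq_mul_div, mul_div_assoc, exp_aeval_theta_mul] at h
  convert h using 2 with k
  rw [Function.comp_apply, smul_mul_assoc, map_smul, expLinear_apply, omega, PowerSeries.coeff_mk,
    div_eq_inv_mul]

/-! ### The Drinfeld action of the Weil operator -/

lemma diamond_add (P Q : Fq[X][X]) (μ : CInfty Fq) :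
    φ.diamond (P + Q) μ = φ.diamond P μ + φ.diamond Q μ :=
  sum_add_index _ _ _ (by simp) fun _ _ _ => by rw [Polynomial.map_add, add_mul]

lemma diamond_sum (s : Finset ℕ) (P : ℕ → Fq[X][X]) (μ : CInfty Fq) :
    φ.diamond (∑ i ∈ s, P i) μ = ∑ i ∈ s, φ.diamond (P i) μ :=
  map_sum (⟨⟨fun P => φ.diamond P μ, sum_zero_index _⟩, fun P Q => φ.diamond_add P Q μ⟩ :
    Fq[X][X] →+ (CInfty Fq)[X]) P s

lemma diamond_map_C_mul_C_X_pow (a : Fq[X]) (k : ℕ) (μ : CInfty Fq) :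
    φ.diamond (a.map C * C (X ^ k)) μ = C (φ.phi a μ) * X ^ k := by
  induction a using Polynomial.induction_on' with
  | add a b ha hb =>
    rw [Polynomial.map_add, add_mul, diamond_add, ha, hb, map_add, LinearMap.add_apply, C_add,
      add_mul]
  | monomial n c =>
    rw [map_monomial, monomial_mul_C, diamond, sum_monomial_index _ _ (by simp),
      ← smul_X_eq_monomial, map_smul, LinearMap.smul_apply, Polynomial.map_mul, map_C,
      Polynomial.map_pow, map_X, Algebra.smul_def, C_mul]
    ring

lemma diamond_weilOperatorTwo (f : Fq[X]) (μ : CInfty Fq) :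
    φ.diamond (weilOperatorTwo f) μ =
      ∑ i ∈ Finset.range f.natDegree, C (φ.phi (dualMap f (X ^ i)) μ) * X ^ i := by
  simp only [weilOperatorTwo, diamond_sum, diamond_map_C_mul_C_X_pow]

end DrinfeldModule

end DrinfeldWeil
end

theorem mainTheorem2 {Fq : Type*} [Field Fq] [Fintype Fq] (φ : DrinfeldModule Fq)
    {f : Fq[X]} (hf : f.Monic) {z : CInfty Fq} (hz : z ∈ φ.lattice) :
    -- the remainder in terms of its own top coefficient
    (0 < f.natDegree →
      remainder hf (φ.omega z) =
          φ.diamond (weilOperatorTwo f) ((remainder hf (φ.omega z)).coeff (f.natDegree - 1)) ∧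
      remainder hf (φ.omega z) =
          ∑ i ∈ Finset.range f.natDegree,
            C (φ.phi (dualMap f (X ^ i))
              ((remainder hf (φ.omega z)).coeff (f.natDegree - 1))) * X ^ i) ∧
    -- the remainder in terms of `exp_φ(z / 𝔣(θ))`
    remainder hf (φ.omega z) =
        φ.diamond (weilOperatorTwo f) (φ.exp (z / aeval (theta Fq) f)) ∧
    remainder hf (φ.omega z) =
        ∑ i ∈ Finset.range f.natDegree,
          C (φ.phi (dualMap f (X ^ i)) (φ.exp (z / aeval (theta Fq) f))) * X ^ i ∧
    -- the coefficients `C_{z,i}`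
    (∀ i < f.natDegree,
      (remainder hf (φ.omega z)).coeff i =
        φ.phi (dualMap f (X ^ i)) (φ.exp (z / aeval (theta Fq) f))) ∧
    -- the leading coefficient `C_{z,n-1}`
    (0 < f.natDegree →
      (remainder hf (φ.omega z)).coeff (f.natDegree - 1) =
        φ.exp (z / aeval (theta Fq) f)) := by
  have hcoeff : ∀ i < f.natDegree, (remainder hf (φ.omega z)).coeff i =
      φ.phi (dualMap f (X ^ i)) (φ.exp (z / aeval (theta Fq) f)) :=
    fun i hi => φ.coeff_remainder_omega hf z hi
  have hrem : remainder hf (φ.omega z) = ∑ i ∈ Finset.range f.natDegree,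
      C (φ.phi (dualMap f (X ^ i)) (φ.exp (z / aeval (theta Fq) f))) * X ^ i := by
    ext j
    simp only [finsetSum_coeff, coeff_C_mul_X_pow]
    rw [Finset.sum_ite_eq]
    split_ifs with hj
    · exact hcoeff j (Finset.mem_range.1 hj)
    · exact coeff_remainder_of_natDegree_le hf _ (not_lt.1 fun h => hj (Finset.mem_range.2 h))
  -- As `𝔣` is monic, `D_𝔣(x ^ (n - 1)) = a_n = 1`.
  have htop : 0 < f.natDegree → (remainder hf (φ.omega z)).coeff (f.natDegree - 1) =
      φ.exp (z / aeval (theta Fq) f) := by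
    intro hn
    have hlt : f.natDegree - 1 < f.natDegree := by omega
    have hD : dualMap f (X ^ (f.natDegree - 1)) = 1 := by
      rw [dualMap_X_pow hf hlt, show f.natDegree - (f.natDegree - 1) = 1 by omega,
        Finset.sum_range_one, add_zero, show f.natDegree - 1 + 1 = f.natDegree by omega,
        hf.coeff_natDegree, C_1, pow_zero, one_mul]
    rw [hcoeff _ hlt, hD, map_one, Module.End.one_apply]
  refine ⟨fun hn => ?_, ?_, hrem, hcoeff, htop⟩
  · rw [htop hn, φ.diamond_weilOperatorTwo]
    exact ⟨hrem, hrem⟩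
  · rw [φ.diamond_weilOperatorTwo]
    exact hrem
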